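/- For a real $p\in[0,1]$ let $\mu_p$ be the Bernoulli($p$) product measure on Cantor space $2^\omega$: under $\mu_p$ the bits $X(0),X(1),X(2),\dots$ of $X\in 2^\omega$ are mutually independent and each equals $1$ with probability $p$ (and $0$ with probability $1-p$). In Turing reductions, identify $p$ with a binary expansion of it, i.e. a sequence $P\in 2^\omega$ with $p=\sum_{n}P(n)2^{-n-1}$; the result holds for every choice of $P$. **Theorem.** Let $p\in[0,1]$. Each cone strictly above $p$ has $\mu_p$-measure zero: for every $q\in 2^\omega$ with $p<_{\mathrm T}q$, $$\mu_p(\{A\in 2^\omega: A\ge_{\mathrm T} q\})=0.$$ Moreover, for every $q\in 2^\omega$, $$\mu_p(\{A\in 2^\omega: A\ge_{\mathrm T} q\})=1\quad\Longrightarrow\quad q\le_{\mathrm T} p .$$ -/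

import Mathlib

open MeasureTheory ProbabilityTheory
open scoped unitInterval

namespace BernoulliCone

/-- Cantor space `2^ω`, with the product `σ`-algebra. A subset of `ω` is identified with its
characteristic function. -/
abbrev Cantor : Type := ℕ → Fin 2

/-- An infinite binary sequence as a (total) function on the natural numbers with values
in `{0, 1}`. -/
def toPFun (X : Cantor) : ℕ →. ℕ := fun n => Part.some (X n : ℕ)

/-- `X ≤_T Y`: the sequence `X` is computable with oracle `Y`. -/
def TuringLE (X Y : Cantor) : Prop := TuringReducible (toPFun X) (toPFun Y)

/-- `X <_T Y`. -/
def TuringLT (X Y : Cantor) : Prop := TuringLE X Y ∧ ¬ TuringLE Y X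

/-- The cone `{A : A ≥_T q}` with base `q`. -/
def cone (q : Cantor) : Set Cantor := {A | TuringLE q A}

/-- `P` is a binary expansion of the real `p`, that is `p = ∑ₙ P(n) / 2^(n+1)`. -/
def IsBinaryExpansion (P : Cantor) (p : ℝ) : Prop := Real.ofDigits P = p

/-- The Bernoulli measure `μ_p` on Cantor space: the coordinates are independent, and each of
them is `1` with probability `p` and `0` with probability `1 - p`. -/
noncomputable def bernoulliProduct (p : I) : Measure Cantor :=
  Measure.infinitePi fun _ : ℕ => bernoulliMeasure (1 : Fin 2) (0 : Fin 2) p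

end BernoulliCone

/-! Both claims follow from one fact, `turingLE_of_measure_cone_ne_zero`: a cone of nonzero measure
has its base `q` computable from `P`. The argument is a majority vote in the style of Sacks. By the
use principle (`exists_approximates`), the cone is covered by countably many sets, one for each code
computing `q` from initial segments of the oracle. If the cone is not null, neither is one of these
sets, say `S` with code `c`; by `exists_clopen_density` it fills more than half of some clopen `C`.
Choose a rational `t` strictly between `μ C - μ (S ∩ C)` and `μ (S ∩ C)`. For each `n`, the oracles
in `C` on which `c` outputs the right bit have mass above `t`, while those on which a wrong bit
appears have mass below `t`. The mass of a clopen set is a polynomial in `p` and `1 - p`, and the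
digits of `P` yield rational lower bounds converging to it (`lowMass_le`, `tendsto_lowMass`). A
search through initial segments of `P` therefore finds the bit whose mass exceeds `t`. The data `c`,
`C`, `t` are finite and are hard-wired into the search. -/

namespace BernoulliCone

/-! ### Initial segments and the use principle. -/

/-- The initial segment of length `k` of a binary sequence. -/
def initSeg (A : Cantor) (k : ℕ) : List (Fin 2) := (List.range k).map A

@[simp] theorem length_initSeg (A : Cantor) (k : ℕ) : (initSeg A k).length = k := by
  simp [initSeg]

theorem initSeg_succ (A : Cantor) (k : ℕ) : initSeg A (k + 1) = initSeg A k ++ [A k] := by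
  simp [initSeg, List.range_succ]

theorem take_initSeg (A : Cantor) {j k : ℕ} (h : j ≤ k) :
    (initSeg A k).take j = initSeg A j := by
  simp [initSeg, ← List.map_take, List.take_range, h]

theorem initSeg_prefix (A : Cantor) {j k : ℕ} (h : j ≤ k) : initSeg A j <+: initSeg A k := by
  rw [← take_initSeg A h]; exact List.take_prefix _ _

theorem getElem?_initSeg (A : Cantor) (k n : ℕ) :
    (initSeg A k)[n]? = if n < k then some (A n) else none := by
  unfold initSeg
  split_ifs with h <;> simp [h]

/-- `F` is monotone in its oracle argument, a finite binary string. -/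
def PrefixMonotone (F : List (Fin 2) → ℕ →. ℕ) : Prop :=
  ∀ u v, u <+: v → ∀ n m, m ∈ F u n → m ∈ F v n

/-- `F` computes the partial function `f` from finite initial segments of the oracle `A`. -/
structure Approximates (A : Cantor) (F : List (Fin 2) → ℕ →. ℕ) (f : ℕ →. ℕ) : Prop where
  partrec : Partrec₂ F
  mono : PrefixMonotone F
  mem_iff : ∀ n m, m ∈ f n ↔ ∃ k, m ∈ F (initSeg A k) n

namespace Approximates

variable {A : Cantor} {F G : List (Fin 2) → ℕ →. ℕ} {f g : ℕ →. ℕ}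

theorem mem_of_le (h : PrefixMonotone F) {j k : ℕ} (hjk : j ≤ k) {n m : ℕ}
    (hm : m ∈ F (initSeg A j) n) : m ∈ F (initSeg A k) n :=
  h _ _ (initSeg_prefix A hjk) _ _ hm

theorem of_partrec (hf : Nat.Partrec f) : Approximates A (fun _ => f) f where
  partrec := (Partrec.nat_iff.2 hf).comp Computable.snd
  mono _ _ _ _ _ h := h
  mem_iff _ _ := ⟨fun h => ⟨0, h⟩, fun ⟨_, h⟩ => h⟩

theorem oracle : Approximates A (fun u n => ((u[n]?.map fun b : Fin 2 => (b : ℕ)) : Option ℕ))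
    (toPFun A) where
  partrec := by
    refine Computable.ofOption (Primrec.to_comp ?_)
    refine Primrec.option_map (Primrec.list_getElem?.comp Primrec.fst Primrec.snd) ?_
    exact Primrec.fin_val.comp Primrec.snd
  mono u v h n m hm := by
    obtain ⟨ρ, rfl⟩ := h
    simp only [Part.mem_coe, Option.mem_def, Option.map_eq_some_iff] at hm ⊢
    obtain ⟨b, hb, rfl⟩ := hm
    refine ⟨b, ?_, rfl⟩
    obtain ⟨h', -⟩ := List.getElem?_eq_some_iff.1 hb
    rw [List.getElem?_append_left h', hb]
  mem_iff n m := by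
    simp only [toPFun, Part.mem_some_iff, Part.mem_coe, Option.mem_def, Option.map_eq_some_iff,
      getElem?_initSeg]
    constructor
    · rintro rfl
      exact ⟨n + 1, A n, by simp, rfl⟩
    · rintro ⟨k, b, hb, rfl⟩
      split_ifs at hb
      cases hb; rfl

theorem pair (hF : Approximates A F f) (hG : Approximates A G g) :
    Approximates A (fun u n => Nat.pair <$> F u n <*> G u n)
      (fun n => Nat.pair <$> f n <*> g n) where
  partrec := by
    have h : Partrec fun p : List (Fin 2) × ℕ =>
        (F p.1 p.2).bind fun a => (G p.1 p.2).map fun b => Nat.pair a b := by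
      refine Partrec.bind hF.partrec (Partrec.map
        (hG.partrec.comp (Computable.fst.comp Computable.fst)
          (Computable.snd.comp Computable.fst)) ?_)
      exact (Primrec₂.natPair.comp (Primrec.snd.comp Primrec.fst) Primrec.snd).to_comp
    refine h.of_eq fun p => ?_
    simp [Seq.seq, Part.bind_map]
  mono u v h n m := by
    simp only [Seq.seq, Part.map_eq_map, Part.mem_bind_iff, Part.mem_map_iff]
    rintro ⟨_, ⟨a, ha, rfl⟩, b, hb, rfl⟩
    exact ⟨_, ⟨a, hF.mono _ _ h _ _ ha, rfl⟩, b, hG.mono _ _ h _ _ hb, rfl⟩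
  mem_iff n m := by
    simp only [Seq.seq, Part.map_eq_map, Part.mem_bind_iff, Part.mem_map_iff]
    constructor
    · rintro ⟨_, ⟨a, ha, rfl⟩, b, hb, rfl⟩
      obtain ⟨j, hj⟩ := (hF.mem_iff _ _).1 ha
      obtain ⟨k, hk⟩ := (hG.mem_iff _ _).1 hb
      exact ⟨max j k, _, ⟨a, mem_of_le hF.mono (le_max_left _ _) hj, rfl⟩, b,
        mem_of_le hG.mono (le_max_right _ _) hk, rfl⟩
    · rintro ⟨k, _, ⟨a, ha, rfl⟩, b, hb, rfl⟩
      exact ⟨_, ⟨a, (hF.mem_iff _ _).2 ⟨k, ha⟩, rfl⟩, b, (hG.mem_iff _ _).2 ⟨k, hb⟩, rfl⟩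

theorem comp (hF : Approximates A F f) (hG : Approximates A G g) :
    Approximates A (fun u n => (G u n).bind (F u)) (fun n => (g n).bind f) where
  partrec := Partrec.bind hG.partrec
    (hF.partrec.comp (Computable.fst.comp Computable.fst) Computable.snd)
  mono u v h n m := by
    intro hm
    obtain ⟨a, ha, hb⟩ := Part.mem_bind_iff.1 hm
    exact Part.mem_bind_iff.2 ⟨a, hG.mono _ _ h _ _ ha, hF.mono _ _ h _ _ hb⟩
  mem_iff n m := by
    constructor
    · intro hm
      obtain ⟨a, ha, hb⟩ := Part.mem_bind_iff.1 hm
      obtain ⟨j, hj⟩ := (hG.mem_iff _ _).1 ha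
      obtain ⟨k, hk⟩ := (hF.mem_iff _ _).1 hb
      exact ⟨max j k, Part.mem_bind_iff.2 ⟨a, mem_of_le hG.mono (le_max_left _ _) hj,
        mem_of_le hF.mono (le_max_right _ _) hk⟩⟩
    · rintro ⟨k, hm⟩
      obtain ⟨a, ha, hb⟩ := Part.mem_bind_iff.1 hm
      exact Part.mem_bind_iff.2 ⟨a, (hG.mem_iff _ _).2 ⟨k, ha⟩, (hF.mem_iff _ _).2 ⟨k, hb⟩⟩

/-- The partial function defined by primitive recursion from `f` and `g`. -/
def primRec (f g : ℕ →. ℕ) (a n : ℕ) : Part ℕ :=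
  n.rec (f a) fun y IH => IH.bind fun i => g (Nat.pair a (Nat.pair y i))

/-- Serves both to lengthen the oracle segment and to pass from the approximations to their limit.
-/
theorem primRec_mono {f g f' g' : ℕ →. ℕ} (hf : ∀ n m, m ∈ f n → m ∈ f' n)
    (hg : ∀ n m, m ∈ g n → m ∈ g' n) (a n m : ℕ) (h : m ∈ primRec f g a n) :
    m ∈ primRec f' g' a n := by
  induction n generalizing m with
  | zero => exact hf _ _ h
  | succ n ih =>
    obtain ⟨i, hi, hm⟩ := Part.mem_bind_iff.1 h
    exact Part.mem_bind_iff.2 ⟨i, ih _ hi, hg _ _ hm⟩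

theorem prec (hF : Approximates A F f) (hG : Approximates A G g) :
    Approximates A (fun u p => primRec (F u) (G u) p.unpair.1 p.unpair.2)
      (fun p => primRec f g p.unpair.1 p.unpair.2) where
  partrec := by
    refine Partrec.nat_rec (f := fun p : List (Fin 2) × ℕ => p.2.unpair.2)
      (g := fun p => F p.1 p.2.unpair.1)
      (h := fun p yi => G p.1 (Nat.pair p.2.unpair.1 (Nat.pair yi.1 yi.2))) ?_ ?_ ?_
    · exact (Primrec.snd.comp (Primrec.unpair.comp Primrec.snd)).to_comp
    · exact hF.partrec.comp Computable.fst
        (Primrec.fst.comp (Primrec.unpair.comp Primrec.snd)).to_comp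
    · refine hG.partrec.comp (Computable.fst.comp Computable.fst) (Primrec.to_comp ?_)
      refine Primrec₂.natPair.comp
        (Primrec.fst.comp (Primrec.unpair.comp (Primrec.snd.comp Primrec.fst))) ?_
      exact Primrec₂.natPair.comp (Primrec.fst.comp Primrec.snd) (Primrec.snd.comp Primrec.snd)
  mono u v h p m := primRec_mono (hF.mono _ _ h) (hG.mono _ _ h) _ _ _
  mem_iff p m := by
    constructor
    · generalize p.unpair.1 = a
      generalize p.unpair.2 = n
      intro h
      induction n generalizing m with
      | zero => exact (hF.mem_iff _ _).1 h
      | succ n ih =>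
        obtain ⟨i, hi, hm⟩ := Part.mem_bind_iff.1 h
        obtain ⟨j, hj⟩ := ih _ hi
        obtain ⟨k, hk⟩ := (hG.mem_iff _ _).1 hm
        refine ⟨max j k, Part.mem_bind_iff.2 ⟨i, ?_, mem_of_le hG.mono (le_max_right _ _) hk⟩⟩
        have hp := initSeg_prefix A (le_max_left j k)
        exact primRec_mono (hF.mono _ _ hp) (hG.mono _ _ hp) _ _ _ hj
    · rintro ⟨k, hk⟩
      exact primRec_mono (fun _ _ h => (hF.mem_iff _ _).2 ⟨k, h⟩)
        (fun _ _ h => (hG.mem_iff _ _).2 ⟨k, h⟩) _ _ _ hk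

/-- The condition involves only values that `f` actually takes, so it persists when more values
become available; this makes minimisation monotone in the oracle segment. -/
theorem mem_rfind_iff {f : ℕ →. ℕ} {a n : ℕ} :
    n ∈ Nat.rfind (fun n => (fun m => decide (m = 0)) <$> f (Nat.pair a n)) ↔
      0 ∈ f (Nat.pair a n) ∧ ∀ j < n, ∃ m, m ≠ 0 ∧ m ∈ f (Nat.pair a j) := by
  refine Nat.mem_rfind.trans ?_
  simp [and_comm]

theorem rfind (hF : Approximates A F f) :
    Approximates A
      (fun u a => Nat.rfind fun n => (fun m => decide (m = 0)) <$> F u (Nat.pair a n))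
      (fun a => Nat.rfind fun n => (fun m => decide (m = 0)) <$> f (Nat.pair a n)) where
  partrec := by
    refine Partrec.rfind (Partrec.map
      (hF.partrec.comp (Computable.fst.comp Computable.fst) ?_) ?_)
    · exact (Primrec₂.natPair.comp (Primrec.snd.comp Primrec.fst) Primrec.snd).to_comp
    · exact (Primrec.eq.comp Primrec.snd (Primrec.const 0)).decide.to_comp
  mono u v h a n := by
    rw [mem_rfind_iff, mem_rfind_iff]
    rintro ⟨h0, h1⟩
    refine ⟨hF.mono _ _ h _ _ h0, fun j hj => ?_⟩
    obtain ⟨m, hm, hm'⟩ := h1 j hj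
    exact ⟨m, hm, hF.mono _ _ h _ _ hm'⟩
  mem_iff a n := by
    simp only [mem_rfind_iff]
    constructor
    · rintro ⟨h0, h1⟩
      obtain ⟨k, hk⟩ := (hF.mem_iff _ _).1 h0
      have : ∀ j, ∃ l, j < n → ∃ m, m ≠ 0 ∧ m ∈ F (initSeg A l) (Nat.pair a j) := by
        intro j
        by_cases hj : j < n
        · obtain ⟨m, hm, hm'⟩ := h1 j hj
          obtain ⟨l, hl⟩ := (hF.mem_iff _ _).1 hm'
          exact ⟨l, fun _ => ⟨m, hm, hl⟩⟩
        · exact ⟨0, fun h => absurd h hj⟩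
      choose l hl using this
      -- Only finitely many values are consulted, so one segment length serves them all.
      refine ⟨max k ((Finset.range n).sup l), mem_of_le hF.mono (le_max_left _ _) hk,
        fun j hj => ?_⟩
      obtain ⟨m, hm, hm'⟩ := hl j hj
      exact ⟨m, hm, mem_of_le hF.mono (le_max_of_le_right
        (Finset.le_sup (f := l) (Finset.mem_range.2 hj))) hm'⟩
    · rintro ⟨k, h0, h1⟩
      refine ⟨(hF.mem_iff _ _).2 ⟨k, h0⟩, fun j hj => ?_⟩
      obtain ⟨m, hm, hm'⟩ := h1 j hj
      exact ⟨m, hm, (hF.mem_iff _ _).2 ⟨k, hm'⟩⟩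

end Approximates

/-- The use principle: a function recursive in `A` is computed from initial segments of `A`. -/
theorem exists_approximates {A : Cantor} {f : ℕ →. ℕ} (h : Nat.RecursiveIn {toPFun A} f) :
    ∃ F, Approximates A F f := by
  induction h with
  | zero => exact ⟨_, .of_partrec .zero⟩
  | succ => exact ⟨_, .of_partrec .succ⟩
  | left => exact ⟨_, .of_partrec .left⟩
  | right => exact ⟨_, .of_partrec .right⟩
  | oracle g hg => rw [Set.mem_singleton_iff.1 hg]; exact ⟨_, .oracle⟩
  | pair _ _ ihf ihg => exact ⟨_, ihf.choose_spec.pair ihg.choose_spec⟩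
  | comp _ _ ihf ihg => exact ⟨_, ihf.choose_spec.comp ihg.choose_spec⟩
  | prec _ _ ihf ihg => exact ⟨_, ihf.choose_spec.prec ihg.choose_spec⟩
  | rfind _ ihf => exact ⟨_, ihf.choose_spec.rfind⟩

/-! ### Search through initial segments of an oracle. -/

theorem recursiveIn_comp {O : Set (ℕ →. ℕ)} {f g : ℕ → ℕ}
    (hf : Nat.RecursiveIn O fun n => Part.some (f n))
    (hg : Nat.RecursiveIn O fun n => Part.some (g n)) :
    Nat.RecursiveIn O fun n => Part.some (f (g n)) :=
  (hf.comp hg).of_eq fun n => by simp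

theorem recursiveIn_pair {O : Set (ℕ →. ℕ)} {f g : ℕ → ℕ}
    (hf : Nat.RecursiveIn O fun n => Part.some (f n))
    (hg : Nat.RecursiveIn O fun n => Part.some (g n)) :
    Nat.RecursiveIn O fun n => Part.some (Nat.pair (f n) (g n)) :=
  (hf.pair hg).of_eq fun n => by simp [Seq.seq]

theorem recursiveIn_prec {O : Set (ℕ →. ℕ)} {f g : ℕ → ℕ}
    (hf : Nat.RecursiveIn O fun n => Part.some (f n))
    (hg : Nat.RecursiveIn O fun n => Part.some (g n)) :
    Nat.RecursiveIn O fun p => Part.some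
      (p.unpair.2.rec (f p.unpair.1) fun y i => g (Nat.pair p.unpair.1 (Nat.pair y i)) : ℕ) := by
  refine (hf.prec hg).of_eq fun p => ?_
  simp only
  induction p.unpair.2 with
  | zero => rfl
  | succ n ih =>
    simp only [] at ih ⊢
    rw [ih]
    simp

/-- Initial segments of the oracle, as codes, are recursive in it. -/
theorem recursiveIn_initSeg (P : Cantor) :
    Nat.RecursiveIn {toPFun P} fun k => Part.some (Encodable.encode (initSeg P k)) := by
  -- Oracle answers are natural numbers, so the bit is rebuilt by a case split. The default `[]` is
  -- never used on the codes that occur in the recursion.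
  have hstep : Nat.Primrec fun x : ℕ =>
      Encodable.encode (((Encodable.decode (α := List (Fin 2)) x.unpair.1).getD []) ++
        [if x.unpair.2 = 1 then (1 : Fin 2) else 0]) := by
    rw [← Primrec.nat_iff]
    refine Primrec.encode.comp (Primrec.list_concat.comp ?_ ?_)
    · exact Primrec.option_getD.comp (Primrec.decode.comp (Primrec.fst.comp Primrec.unpair))
        (Primrec.const [])
    · exact Primrec.ite (Primrec.eq.comp (Primrec.snd.comp Primrec.unpair) (Primrec.const 1))
        (Primrec.const 1) (Primrec.const 0)
  have h0 := Nat.Primrec.recursiveIn (O := {toPFun P})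
    (Nat.Primrec.const (Encodable.encode ([] : List (Fin 2))))
  have hy := Nat.Primrec.recursiveIn (O := {toPFun P}) (Nat.Primrec.left.comp .right)
  have hi := Nat.Primrec.recursiveIn (O := {toPFun P}) (Nat.Primrec.right.comp .right)
  have hP : Nat.RecursiveIn {toPFun P} fun n => Part.some (P n : ℕ) :=
    .oracle _ (Set.mem_singleton _)
  have h := recursiveIn_prec h0 (recursiveIn_comp hstep.recursiveIn
    (recursiveIn_pair hi (recursiveIn_comp hP hy)))
  have hd := Nat.Primrec.recursiveIn (O := {toPFun P}) ((Nat.Primrec.const 0).pair .id)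
  refine (recursiveIn_comp h hd).of_eq fun k => congrArg _ ?_
  simp only [Nat.unpair_pair, id]
  induction k with
  | zero => rfl
  | succ k ih =>
    have : (if (P k : ℕ) = 1 then (1 : Fin 2) else 0) = P k := by
      generalize P k = b
      fin_cases b <;> rfl
    refine (congrArg (fun i => Encodable.encode
      (((Encodable.decode (α := List (Fin 2)) i).getD []) ++
        [if (P k : ℕ) = 1 then (1 : Fin 2) else 0])) ih).trans ?_
    simp only [Encodable.encodek, Option.getD_some, initSeg_succ, this]

/-- A sequence is computable in `P` if its values can be found by a computable search through
the initial segments of `P`. -/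
theorem turingLE_of_search {P q : Cantor} {g : List (Fin 2) → ℕ → Option ℕ}
    (hg : Computable₂ g) (hsound : ∀ s n m, g (initSeg P s) n = some m → m = q n)
    (hcomplete : ∀ n, ∃ s, (g (initSeg P s) n).isSome) : TuringLE q P := by
  -- Answers are shifted by one so that `0` can mean "no answer yet"; `Nat.pred` undoes the shift.
  let G : ℕ → ℕ := fun x =>
    ((Encodable.decode (α := List (Fin 2)) x.unpair.2).bind fun v => g v x.unpair.1).elim 0
      Nat.succ
  have hG : Computable G := by
    have h : Computable fun x : ℕ =>
        (Encodable.decode (α := List (Fin 2)) x.unpair.2).bind fun v => g v x.unpair.1 := by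
      refine Computable.option_bind ?_ ?_
      · exact (Primrec.decode.comp (Primrec.snd.comp Primrec.unpair)).to_comp
      · exact hg.comp Computable.snd
          ((Primrec.fst.comp Primrec.unpair).to_comp.comp Computable.fst)
    have h' : Primrec fun o : Option ℕ => o.elim 0 Nat.succ := by
      refine (Primrec.option_casesOn Primrec.id (Primrec.const 0)
        (Primrec.succ.comp Primrec.snd).to₂).of_eq fun o => ?_
      cases o <;> rfl
    exact h'.to_comp.comp h
  have hGeq : ∀ n s, G (Nat.pair n (Encodable.encode (initSeg P s))) =
      (g (initSeg P s) n).elim 0 Nat.succ := fun n s => by simp [G]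
  have hO := recursiveIn_initSeg P
  have hGr : Nat.RecursiveIn {toPFun P} fun x => Part.some (G x) :=
    Nat.Partrec.recursiveIn (Partrec.nat_iff.1 hG.partrec)
  have hval : Nat.RecursiveIn {toPFun P} fun x =>
      Part.some (G (Nat.pair x.unpair.1 (Encodable.encode (initSeg P x.unpair.2)))) :=
    recursiveIn_comp hGr (recursiveIn_pair .left (recursiveIn_comp hO .right))
  -- `Nat.rfind` looks for a zero, and `1 - x` vanishes exactly when `x` is nonzero, that is, when
  -- an answer is present.
  have hsub : Nat.Primrec fun x => 1 - x := by
    rw [← Primrec.nat_iff]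
    exact Primrec.nat_sub.comp (Primrec.const 1) Primrec.id
  have hpred : Nat.Primrec Nat.pred := Primrec.nat_iff.1 Primrec.pred
  have hfind := (recursiveIn_comp hsub.recursiveIn hval).rfind
  have hall := (recursiveIn_comp hpred.recursiveIn hval).comp
    (Nat.Primrec.id.recursiveIn.pair hfind)
  rw [TuringLE, TuringReducible, RecursiveIn.iff_nat]
  refine hall.of_eq_tot fun n => ?_
  have hex := hcomplete n
  obtain ⟨m, hm⟩ := Option.isSome_iff_exists.1 (Nat.find_spec hex)
  obtain rfl := hsound _ _ _ hm
  have hf : Nat.find hex ∈ Nat.rfind fun j => (fun m => decide (m = 0)) <$>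
      Part.some (1 - G (Nat.pair (Nat.pair n j).unpair.1
        (Encodable.encode (initSeg P (Nat.pair n j).unpair.2)))) := by
    refine Nat.mem_rfind.2 ⟨?_, fun {j} hj => ?_⟩
    · simp [hGeq, hm]
    · have := Nat.find_min hex hj
      simp only [Bool.not_eq_true, Option.isSome_eq_false_iff, Option.isNone_iff_eq_none] at this
      simp [hGeq, this]
  refine Part.mem_bind_iff.2 ⟨Nat.pair n (Nat.find hex), ?_, ?_⟩
  · simp only [Seq.seq, Part.map_eq_map, Part.mem_bind_iff, Part.mem_map_iff]
    exact ⟨_, ⟨n, by simp, rfl⟩, _, hf, rfl⟩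
  · simp [hGeq, hm]

/-! ### Measures of cylinders and clopen sets; density. -/

theorem initSeg_eq_initSeg_iff {A B : Cantor} {n : ℕ} :
    initSeg A n = initSeg B n ↔ ∀ i < n, A i = B i := by
  simp [initSeg, List.map_inj_left]

/-- The list of binary strings of length `n`. -/
def words : ℕ → List (List (Fin 2))
  | 0 => [[]]
  | n + 1 => (words n).flatMap fun v => [v ++ [0], v ++ [1]]

theorem mem_words {n : ℕ} {v : List (Fin 2)} : v ∈ words n ↔ v.length = n := by
  induction n generalizing v with
  | zero => simp [words]
  | succ n ih =>
    simp only [words, List.mem_flatMap, ih, List.mem_cons, List.not_mem_nil, or_false]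
    constructor
    · rintro ⟨u, rfl, rfl | rfl⟩ <;> simp
    · intro h
      obtain rfl | ⟨u, b, rfl⟩ := List.eq_nil_or_concat' v
      · simp at h
      refine ⟨u, by simpa using h, ?_⟩
      fin_cases b <;> simp

theorem nodup_words (n : ℕ) : (words n).Nodup := by
  induction n with
  | zero => simp [words]
  | succ n ih =>
    refine List.nodup_flatMap.2 ⟨fun v _ => by simp, ih.imp fun {u v} huv => ?_⟩
    simp only [Function.onFun, List.disjoint_left, List.mem_cons, List.not_mem_nil, or_false]
    rintro w (rfl | rfl) (h | h) <;> simp_all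

/-- The probability of a single bit under the Bernoulli measure. -/
noncomputable def bias (p : I) (b : Fin 2) : ℝ := if b = 1 then p else 1 - p

instance (p : I) : IsProbabilityMeasure (bernoulliProduct p) := by
  unfold bernoulliProduct; infer_instance

theorem bernoulliMeasure_real_singleton (p : I) (b : Fin 2) :
    (bernoulliMeasure (1 : Fin 2) (0 : Fin 2) p).real {b} = bias p b := by
  fin_cases b <;> simp [bias, bernoulliMeasure_def, Measure.real]

/-- Writes a cylinder as a finite box, the form whose product measure is known. -/
theorem setOf_initSeg_eq (v : List (Fin 2)) : {A : Cantor | initSeg A v.length = v} =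
    Set.pi (Finset.range v.length) fun i => {v.getD i 0} := by
  ext A
  simp only [Set.mem_ofPred_eq, Set.mem_pi, Finset.coe_range, Set.mem_Iio, Set.mem_singleton_iff]
  have : v = initSeg (fun i => v.getD i 0) v.length := by
    refine List.ext_getElem? fun i => ?_
    rw [getElem?_initSeg]
    split_ifs with h
    · simp [h]
    · simpa using h
  conv_lhs => rhs; rw [this]
  exact initSeg_eq_initSeg_iff

theorem measurableSet_initSeg_eq (n : ℕ) (v : List (Fin 2)) :
    MeasurableSet {A : Cantor | initSeg A n = v} := by
  by_cases h : v.length = n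
  · subst h
    rw [setOf_initSeg_eq]
    exact MeasurableSet.pi (Finset.countable_toSet _) fun _ _ => measurableSet_singleton _
  · convert MeasurableSet.empty
    refine Set.eq_empty_of_forall_notMem fun A hA => h ?_
    rw [← hA, length_initSeg]

theorem measureReal_initSeg_eq (p : I) (v : List (Fin 2)) :
    (bernoulliProduct p).real {A | initSeg A v.length = v} = (v.map (bias p)).prod := by
  rw [setOf_initSeg_eq, Measure.real, bernoulliProduct,
    Measure.infinitePi_pi _ fun _ _ => measurableSet_singleton _, ENNReal.toReal_prod]
  change ∏ i ∈ Finset.range v.length, (bernoulliMeasure (1 : Fin 2) (0 : Fin 2) p).real _ = _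
  simp only [bernoulliMeasure_real_singleton]
  induction v using List.reverseRecOn with
  | nil => simp
  | append_singleton v b ih =>
    rw [List.length_append, List.length_singleton, Finset.prod_range_succ, List.map_append,
      List.prod_append, ← ih]
    congr 1
    · refine Finset.prod_congr rfl fun i hi => ?_
      rw [List.getD_append _ _ _ _ (Finset.mem_range.1 hi)]
    · simp

theorem setOf_initSeg (T : List (Fin 2) → Prop) [DecidablePred T] (n : ℕ) :
    {A : Cantor | T (initSeg A n)} =
      ⋃ v ∈ (words n).toFinset.filter T, {A : Cantor | initSeg A n = v} := by
  ext A
  simp [mem_words]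

theorem measurableSet_initSeg (T : List (Fin 2) → Prop) (n : ℕ) :
    MeasurableSet {A : Cantor | T (initSeg A n)} := by
  classical
  rw [setOf_initSeg]
  exact Finset.measurableSet_biUnion _ fun v _ => measurableSet_initSeg_eq n v

theorem measureReal_initSeg (p : I) (T : List (Fin 2) → Prop) [DecidablePred T] (n : ℕ) :
    (bernoulliProduct p).real {A | T (initSeg A n)} =
      ((words n).map fun v => if T v then (v.map (bias p)).prod else 0).sum := by
  rw [setOf_initSeg, measureReal_biUnion_finset, Finset.sum_filter,
    ← List.sum_toFinset _ (nodup_words n)]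
  · refine Finset.sum_congr rfl fun v hv => ?_
    obtain rfl := mem_words.1 (List.mem_toFinset.1 hv)
    rw [measureReal_initSeg_eq]
  · intro u _ v _ huv
    refine Set.disjoint_left.2 fun A hu hv => huv (hu.symm.trans hv)
  · exact fun v _ => measurableSet_initSeg_eq n v

theorem exists_initSeg_subset {U : Set Cantor} (hU : IsOpen U) {A : Cantor} (hA : A ∈ U) :
    ∃ n, {B | initSeg B n = initSeg A n} ⊆ U := by
  obtain ⟨J, u, hu, hsub⟩ := isOpen_pi_iff.1 hU A hA
  refine ⟨J.sup id + 1, fun B hB => hsub fun i hi => ?_⟩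
  have := initSeg_eq_initSeg_iff.1 hB i (Nat.lt_succ_of_le (Finset.le_sup (f := id) hi))
  rw [this]
  exact (hu i hi).2

/-- A set of positive measure fills more than half of some clopen set. -/
theorem exists_clopen_density (p : I) {S : Set Cantor} (hS : bernoulliProduct p S ≠ 0) :
    ∃ (N : ℕ) (T : List (Fin 2) → Prop),
      bernoulliProduct p {A | T (initSeg A N)} <
        2 * bernoulliProduct p (S ∩ {A | T (initSeg A N)}) := by
  set μ := bernoulliProduct p
  have hfin : μ S ≠ ⊤ := measure_ne_top _ _
  have hlt : μ S < 2 * μ S := by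
    rw [two_mul]; exact ENNReal.lt_add_right hfin hS
  -- Outer regularity applies to arbitrary sets, so `S` need not be measurable.
  obtain ⟨U, hSU, hU, hμU⟩ := Set.exists_isOpen_lt_of_lt S _ hlt
  -- The clopen sets given by `T` at length `n` lie in `U` and increase with `n` to cover `S`, so
  -- twice the mass of their trace on `S` eventually exceeds `μ U`.
  let T : List (Fin 2) → Prop := fun v => {B | initSeg B v.length = v} ⊆ U
  have hT : ∀ n A, T (initSeg A n) ↔ {B | initSeg B n = initSeg A n} ⊆ U := by
    intro n A; simp [T]
  have hmono : Monotone fun n => S ∩ {A | T (initSeg A n)} := by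
    intro m n hmn A hA
    refine ⟨hA.1, (hT _ _).2 fun B hB => (hT _ _).1 hA.2 ?_⟩
    have h : initSeg B n = initSeg A n := hB
    rw [Set.mem_ofPred_eq, ← take_initSeg B hmn, h, take_initSeg A hmn]
  have hunion : ⋃ n, S ∩ {A | T (initSeg A n)} = S := by
    refine Set.Subset.antisymm (Set.iUnion_subset fun n => Set.inter_subset_left) fun A hA => ?_
    obtain ⟨n, hn⟩ := exists_initSeg_subset hU (hSU hA)
    exact Set.mem_iUnion.2 ⟨n, hA, (hT _ _).2 hn⟩
  have hlim := tendsto_measure_iUnion_atTop (μ := μ) hmono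
  rw [hunion] at hlim
  have hlim2 := ENNReal.Tendsto.const_mul (a := 2) hlim (Or.inr (by simp))
  obtain ⟨N, hN⟩ := (hlim2.eventually (lt_mem_nhds hμU)).exists
  refine ⟨N, T, lt_of_le_of_lt (measure_mono fun A hA => (hT _ _).1 hA rfl) hN⟩

/-! ### Rational lower bounds from binary digits. -/

open Filter Topology

/-- The natural number with binary digits `r`, most significant digit first. -/
def binaryVal (r : List (Fin 2)) : ℕ := r.foldl (fun (x : ℕ) (b : Fin 2) => 2 * x + b) 0

theorem binaryVal_append_singleton (r : List (Fin 2)) (b : Fin 2) :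
    binaryVal (r ++ [b]) = 2 * binaryVal r + b := by
  simp [binaryVal]

theorem binaryVal_lt (r : List (Fin 2)) : binaryVal r < 2 ^ r.length := by
  induction r using List.reverseRecOn with
  | nil => simp [binaryVal]
  | append_singleton r b ih =>
    rw [binaryVal_append_singleton, List.length_append, List.length_singleton, pow_succ]
    omega

/-- The numerator, over `2 ^ r.length`, of the lower approximation to `bias p b` given by the
initial segment `r` of a binary expansion of `p`. -/
def lowBias (r : List (Fin 2)) (b : Fin 2) : ℕ :=
  if b = 1 then binaryVal r else 2 ^ r.length - 1 - binaryVal r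

theorem binaryVal_initSeg (P : Cantor) (s : ℕ) :
    (binaryVal (initSeg P s) : ℝ) / 2 ^ s = ∑ i ∈ Finset.range s, Real.ofDigitsTerm P i := by
  induction s with
  | zero => simp [initSeg, binaryVal]
  | succ s ih =>
    rw [Finset.sum_range_succ, ← ih, initSeg_succ, binaryVal_append_singleton, Real.ofDigitsTerm]
    push_cast
    field_simp
    ring

variable {P : Cantor} {p : I}

theorem binaryVal_initSeg_le (hP : IsBinaryExpansion P p) (s : ℕ) :
    (binaryVal (initSeg P s) : ℝ) / 2 ^ s ≤ p := by
  rw [binaryVal_initSeg, ← hP, Real.ofDigits_eq_sum_add_ofDigits P s]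
  have := Real.ofDigits_nonneg fun i => P (i + s)
  have : 0 ≤ ((2 : ℕ) ^ s : ℝ)⁻¹ * Real.ofDigits fun i => P (i + s) := by positivity
  linarith

/-- The tail of the expansion is at most one unit of the last place. Equality is allowed, so
expansions ending in ones are covered. -/
theorem le_binaryVal_initSeg (hP : IsBinaryExpansion P p) (s : ℕ) :
    (p : ℝ) ≤ (binaryVal (initSeg P s) : ℝ) / 2 ^ s + (2 ^ s)⁻¹ := by
  rw [binaryVal_initSeg, ← hP, Real.ofDigits_eq_sum_add_ofDigits P s]
  have h1 := Real.ofDigits_le_one fun i => P (i + s)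
  have h2 : (0 : ℝ) < (2 ^ s)⁻¹ := by positivity
  push_cast
  nlinarith

/-- The extra unit subtracted in `lowBias` makes this a lower bound for `1 - p`, since the digits
read so far underestimate `p`. Natural subtraction does not truncate because of `binaryVal_lt`. -/
theorem lowBias_zero (s : ℕ) : (lowBias (initSeg P s) 0 : ℝ) / 2 ^ s =
    1 - (2 ^ s)⁻¹ - binaryVal (initSeg P s) / 2 ^ s := by
  have h := binaryVal_lt (initSeg P s)
  rw [length_initSeg] at h
  have h' : 2 ^ s - 1 - binaryVal (initSeg P s) + (binaryVal (initSeg P s) + 1) = 2 ^ s := by omega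
  have h'' : (((2 ^ s - 1 - binaryVal (initSeg P s) : ℕ)) : ℝ) =
      2 ^ s - 1 - binaryVal (initSeg P s) := by
    have := congrArg (Nat.cast : ℕ → ℝ) h'
    push_cast at this ⊢
    linarith
  simp only [lowBias, length_initSeg, zero_ne_one, if_false]
  rw [h'']
  field_simp

theorem lowBias_le (hP : IsBinaryExpansion P p) (s : ℕ) (b : Fin 2) :
    (lowBias (initSeg P s) b : ℝ) / 2 ^ s ≤ bias p b := by
  fin_cases b
  · have := le_binaryVal_initSeg hP s
    simp only [Fin.zero_eta, lowBias_zero, bias, zero_ne_one, if_false]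
    linarith
  · simpa [lowBias, bias] using binaryVal_initSeg_le hP s

theorem tendsto_lowBias (hP : IsBinaryExpansion P p) (b : Fin 2) :
    Tendsto (fun s => (lowBias (initSeg P s) b : ℝ) / 2 ^ s) atTop (𝓝 (bias p b)) := by
  have h0 : Tendsto (fun s : ℕ => ((2 : ℝ) ^ s)⁻¹) atTop (𝓝 0) :=
    tendsto_inv_atTop_zero.comp (tendsto_pow_atTop_atTop_of_one_lt one_lt_two)
  have h1 : Tendsto (fun s => (binaryVal (initSeg P s) : ℝ) / 2 ^ s) atTop (𝓝 p) := by
    refine tendsto_of_tendsto_of_tendsto_of_le_of_le (g := fun s : ℕ => (p : ℝ) - (2 ^ s)⁻¹)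
      (by simpa using h0.const_sub (p : ℝ)) tendsto_const_nhds (fun s => ?_)
      (binaryVal_initSeg_le hP)
    have := le_binaryVal_initSeg hP s
    simp only
    linarith
  fin_cases b
  · simp only [Fin.zero_eta, lowBias_zero, bias, zero_ne_one, if_false]
    simpa using (h0.const_sub 1).sub h1
  · simpa [lowBias, bias] using h1

/-- The numerator, over `2 ^ (r.length * L)`, of the lower approximation to the measure of
`{A | T (initSeg A L)}` given by the initial segment `r` of a binary expansion. -/
def lowMass (T : List (Fin 2) → Prop) [DecidablePred T] (r : List (Fin 2)) (L : ℕ) : ℕ :=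
  ((words L).map fun v => if T v then (v.map (lowBias r)).prod else 0).sum

/-- All words involved have length `L`, so `2 ^ (s * L)` is a common denominator; bounds and limits
can then be taken bit by bit. -/
theorem lowMass_div (T : List (Fin 2) → Prop) [DecidablePred T] (r : List (Fin 2)) (L s : ℕ) :
    (lowMass T r L : ℝ) / 2 ^ (s * L) = ((words L).map fun v =>
      if T v then (v.map fun b => (lowBias r b : ℝ) / 2 ^ s).prod else 0).sum := by
  have hprod : ∀ v : List (Fin 2), (v.map fun b => (lowBias r b : ℝ) / 2 ^ s).prod =
      ((v.map (lowBias r)).prod : ℕ) / 2 ^ (s * v.length) := by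
    intro v
    induction v with
    | nil => simp
    | cons b v ih =>
      simp only [List.map_cons, List.prod_cons, ih, List.length_cons]
      push_cast
      rw [mul_add, pow_add, mul_one]
      field_simp
  rw [lowMass, Nat.cast_list_sum, List.map_map, div_eq_mul_inv, ← List.sum_map_mul_right]
  refine congrArg List.sum (List.map_congr_left fun v hv => ?_)
  rw [hprod, mem_words.1 hv]
  simp only [Function.comp]
  split_ifs <;> simp [div_eq_mul_inv]

theorem lowMass_le (hP : IsBinaryExpansion P p) (T : List (Fin 2) → Prop) [DecidablePred T]
    (L s : ℕ) : (lowMass T (initSeg P s) L : ℝ) / 2 ^ (s * L) ≤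
      (bernoulliProduct p).real {A | T (initSeg A L)} := by
  rw [lowMass_div, measureReal_initSeg]
  refine List.sum_le_sum fun v hv => ?_
  split_ifs with hT
  · clear hv hT
    induction v with
    | nil => simp
    | cons b v ih =>
      simp only [List.map_cons, List.prod_cons]
      have h0 : (0 : ℝ) ≤ lowBias (initSeg P s) b / 2 ^ s := by positivity
      refine mul_le_mul (lowBias_le hP s b) ih (List.prod_nonneg ?_)
        (h0.trans (lowBias_le hP s b))
      simp only [List.mem_map]
      rintro _ ⟨b, -, rfl⟩
      positivity
  · rfl

theorem tendsto_lowMass (hP : IsBinaryExpansion P p) (T : List (Fin 2) → Prop) [DecidablePred T]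
    (L : ℕ) : Tendsto (fun s => (lowMass T (initSeg P s) L : ℝ) / 2 ^ (s * L)) atTop
      (𝓝 ((bernoulliProduct p).real {A | T (initSeg A L)})) := by
  simp only [lowMass_div, measureReal_initSeg]
  refine tendsto_list_sum _ fun v _ => ?_
  split_ifs
  · exact tendsto_list_prod _ fun b _ => tendsto_lowBias hP b
  · exact tendsto_const_nhds

/-! ### The majority vote and its computability. -/

/-- The string `v` of length `L` has its prefix of length `N` in `D`, and the code `c` outputs `i`
at input `n` within `L` steps on some prefix of `v` shorter than `L`. -/
def Accepts (c : Nat.Partrec.Code) (D : List (List (Fin 2))) (N i n L : ℕ)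
    (v : List (Fin 2)) : Prop :=
  v.take N ∈ D ∧ ∃ j ∈ List.range L,
    c.evaln L (Nat.pair (Encodable.encode (v.take j)) n) = some i

instance (c : Nat.Partrec.Code) (D : List (List (Fin 2))) (N i n L : ℕ) :
    DecidablePred (Accepts c D N i n L) := fun _ => inferInstanceAs (Decidable (_ ∧ _))

/-- Majority vote search, with threshold `a / b`, through the strings of some length coded by the
length of `r`. -/
def vote (c : Nat.Partrec.Code) (D : List (List (Fin 2))) (N a b : ℕ) (r : List (Fin 2))
    (n : ℕ) : Option ℕ :=
  if a * 2 ^ (r.length * r.length.unpair.1) <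
      b * lowMass (Accepts c D N 0 n r.length.unpair.1) r r.length.unpair.1 then some 0
  else if a * 2 ^ (r.length * r.length.unpair.1) <
      b * lowMass (Accepts c D N 1 n r.length.unpair.1) r r.length.unpair.1 then some 1
  else none

theorem primrec_two_pow : Primrec fun n : ℕ => 2 ^ n :=
  (Primrec.nat_rec₁ 1 (f := fun _ x => 2 * x) (Primrec.nat_double.comp Primrec.snd)).of_eq
    fun n => by
      induction n with
      | zero => rfl
      | succ n ih => rw [pow_succ', ← ih]

theorem primrec_words : Primrec words := by
  have h' : Primrec fun x : (ℕ × List (List (Fin 2))) × List (Fin 2) =>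
      [x.2 ++ [(0 : Fin 2)], x.2 ++ [1]] :=
    Primrec.list_cons.comp (Primrec.list_concat.comp Primrec.snd (Primrec.const 0))
      (Primrec.list_cons.comp (Primrec.list_concat.comp Primrec.snd (Primrec.const 1))
        (Primrec.const []))
  have h : Primrec₂ fun (_ : ℕ) (l : List (List (Fin 2))) =>
      l.flatMap fun v => [v ++ [0], v ++ [1]] :=
    Primrec.list_flatMap Primrec.snd h'
  refine (Primrec.nat_rec₁ [[]] (f := fun _ l => l.flatMap fun v => [v ++ [0], v ++ [1]])
    h).of_eq fun n => ?_
  induction n with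
  | zero => rfl
  | succ n ih => rw [words, ← ih]

theorem primrec_binaryVal : Primrec binaryVal :=
  (Primrec.list_foldl Primrec.id (Primrec.const 0)
    (Primrec.nat_add.comp (Primrec.nat_double.comp (Primrec.fst.comp Primrec.snd))
      (Primrec.fin_val.comp (Primrec.snd.comp Primrec.snd))).to₂).of_eq fun r => by simp [binaryVal]

theorem primrec_lowBias : Primrec₂ lowBias := by
  refine Primrec.ite (Primrec.eq.comp Primrec.snd (Primrec.const 1))
    (primrec_binaryVal.comp Primrec.fst) (Primrec.nat_sub.comp (Primrec.nat_sub.comp ?_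
      (Primrec.const 1)) (primrec_binaryVal.comp Primrec.fst))
  exact primrec_two_pow.comp (Primrec.list_length.comp Primrec.fst)

theorem primrec_list_sum : Primrec (List.sum : List ℕ → ℕ) :=
  Primrec.list_foldr Primrec.id (Primrec.const 0)
    (Primrec.nat_add.comp (Primrec.fst.comp Primrec.snd) (Primrec.snd.comp Primrec.snd)).to₂

theorem primrec_list_prod : Primrec (List.prod : List ℕ → ℕ) :=
  Primrec.list_foldr Primrec.id (Primrec.const 1)
    (Primrec.nat_mul.comp (Primrec.fst.comp Primrec.snd) (Primrec.snd.comp Primrec.snd)).to₂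

theorem primrecPred_mem {α : Type*} [Primcodable α] [DecidableEq α] (D : List α) :
    PrimrecPred fun a => a ∈ D :=
  (Primrec.nat_lt.comp (Primrec.list_idxOf₁ D) (Primrec.const D.length)).of_eq fun _ =>
    List.idxOf_lt_length_iff

theorem primrec_accepts (c : Nat.Partrec.Code) (D : List (List (Fin 2))) (N i : ℕ) :
    PrimrecPred fun x : (ℕ × ℕ) × List (Fin 2) => Accepts c D N i x.1.1 x.1.2 x.2 := by
  refine PrimrecPred.and ((primrecPred_mem D).comp
    (Primrec.list_take.comp (Primrec.const N) Primrec.snd)) ?_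
  have h : PrimrecRel fun (j : ℕ) (x : (ℕ × ℕ) × List (Fin 2)) =>
      c.evaln x.1.2 (Nat.pair (Encodable.encode (x.2.take j)) x.1.1) = some i := by
    refine Primrec.eq.comp (Nat.Partrec.Code.primrec_evaln.comp ((Primrec.pair
      (Primrec.snd.comp (Primrec.fst.comp Primrec.snd)) (Primrec.const c)).pair ?_))
      (Primrec.const (some i))
    exact Primrec₂.natPair.comp (Primrec.encode.comp
      (Primrec.list_take.comp Primrec.fst (Primrec.snd.comp Primrec.snd)))
      (Primrec.fst.comp (Primrec.fst.comp Primrec.snd))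
  exact h.exists_mem_list.comp (Primrec.list_range.comp (Primrec.snd.comp Primrec.fst)) Primrec.id

theorem primrec_lowMass (c : Nat.Partrec.Code) (D : List (List (Fin 2))) (N i : ℕ) :
    Primrec fun x : List (Fin 2) × (ℕ × ℕ) =>
      lowMass (Accepts c D N i x.2.1 x.2.2) x.1 x.2.2 := by
  refine primrec_list_sum.comp (Primrec.list_map
    (primrec_words.comp (Primrec.snd.comp Primrec.snd)) (Primrec.ite ?_ ?_ (Primrec.const 0)))
  · exact (primrec_accepts c D N i).comp
      ((Primrec.snd.comp Primrec.fst).pair Primrec.snd)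
  · exact primrec_list_prod.comp (Primrec.list_map Primrec.snd
      (primrec_lowBias.comp (Primrec.fst.comp (Primrec.fst.comp Primrec.fst)) Primrec.snd).to₂)

theorem primrec_vote (c : Nat.Partrec.Code) (D : List (List (Fin 2))) (N a b : ℕ) :
    Primrec₂ (vote c D N a b) := by
  have hlen : Primrec fun x : List (Fin 2) × ℕ => x.1.length :=
    Primrec.list_length.comp Primrec.fst
  have hL : Primrec fun x : List (Fin 2) × ℕ => x.1.length.unpair.1 :=
    Primrec.fst.comp (Primrec.unpair.comp hlen)
  have htest : ∀ i, PrimrecPred fun x : List (Fin 2) × ℕ =>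
      a * 2 ^ (x.1.length * x.1.length.unpair.1) <
        b * lowMass (Accepts c D N i x.2 x.1.length.unpair.1) x.1 x.1.length.unpair.1 := by
    intro i
    refine Primrec.nat_lt.comp (Primrec.nat_mul.comp (Primrec.const a)
      (primrec_two_pow.comp (Primrec.nat_mul.comp hlen hL)))
      (Primrec.nat_mul.comp (Primrec.const b) ?_)
    exact (primrec_lowMass c D N i).comp (Primrec.fst.pair (Primrec.snd.pair hL))
  exact Primrec.ite (htest 0) (Primrec.const (some 0))
    (Primrec.ite (htest 1) (Primrec.const (some 1)) (Primrec.const none))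

/-! ### From positive measure to computability. -/

/-- The code `c` computes `q` from initial segments of `A`. -/
def Computes (c : Nat.Partrec.Code) (q A : Cantor) : Prop :=
  ∀ n m, m = (q n : ℕ) ↔ ∃ k, m ∈ c.eval (Nat.pair (Encodable.encode (initSeg A k)) n)

theorem exists_computes {q A : Cantor} (h : TuringLE q A) : ∃ c, Computes c q A := by
  rw [TuringLE, TuringReducible, RecursiveIn.iff_nat] at h
  obtain ⟨F, hF⟩ := exists_approximates h
  obtain ⟨c, hc⟩ := Nat.Partrec.Code.exists_code.1 hF.partrec
  refine ⟨c, fun n m => ?_⟩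
  simpa [toPFun, hc] using hF.mem_iff n m

/-- The predicate `T` may be noncomputable, but only its finitely many words of length `N` matter,
and these are stored as a list. The bound `N ≤ L` appears because a shorter string has no prefix of
length `N`. -/
theorem accepts_initSeg_iff {c : Nat.Partrec.Code} {T : List (Fin 2) → Prop} [DecidablePred T]
    {N i n L : ℕ} {A : Cantor} :
    Accepts c ((words N).filter T) N i n L (initSeg A L) ↔ (N ≤ L ∧ T (initSeg A N)) ∧
      ∃ j < L, c.evaln L (Nat.pair (Encodable.encode (initSeg A j)) n) = some i := by
  unfold Accepts
  refine and_congr ?_ (exists_congr fun j => ?_)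
  · simp only [List.mem_filter, mem_words, List.length_take, length_initSeg, decide_eq_true_eq,
      min_eq_left_iff]
    exact and_congr_right fun h => by rw [take_initSeg A h]
  · rw [List.mem_range]
    exact and_congr_right fun h => by rw [take_initSeg A h.le]

/-- If a fixed code computes `q` from more than half of a clopen set of oracles, then `q` is
computable from a binary expansion of `p`. -/
theorem turingLE_of_density {p : I} {P q : Cantor} (hP : IsBinaryExpansion P p)
    {c : Nat.Partrec.Code} {N : ℕ} {T : List (Fin 2) → Prop}
    (h : bernoulliProduct p {A | T (initSeg A N)} <
      2 * bernoulliProduct p ({A | Computes c q A} ∩ {A | T (initSeg A N)})) :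
    TuringLE q P := by
  classical
  set μ := bernoulliProduct p with hμ
  set S : Set Cantor := {A | Computes c q A}
  set C : Set Cantor := {A | T (initSeg A N)}
  have hreal : μ.real C - μ.real (S ∩ C) < μ.real (S ∩ C) := by
    have := (ENNReal.toReal_lt_toReal (measure_ne_top _ _)
      (ENNReal.mul_ne_top (by simp) (measure_ne_top _ _))).2 h
    rw [ENNReal.toReal_mul, ENNReal.toReal_ofNat] at this
    simp only [Measure.real]
    linarith
  obtain ⟨t, ht1, ht2⟩ := exists_rat_btwn hreal
  have ht0 : 0 ≤ t := by
    have : μ.real (S ∩ C) ≤ μ.real C := measureReal_mono Set.inter_subset_right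
    have : (0 : ℝ) < t := by linarith
    exact_mod_cast this.le
  have htd : (t : ℝ) = (t.num.toNat : ℝ) / t.den := by
    have h1 : ((t.num.toNat : ℤ) : ℝ) = t.num := by
      rw [Int.toNat_of_nonneg (Rat.num_nonneg.2 ht0)]
    rw [Rat.cast_def, ← h1, Int.cast_natCast]
  have hden : (0 : ℝ) < t.den := by exact_mod_cast t.den_pos
  set D := (words N).filter T
  let E : ℕ → ℕ → ℕ → Set Cantor := fun i n L => {A | Accepts c D N i n L (initSeg A L)}
  -- Clearing denominators turns the comparison with `t` into the integer test used by `vote`.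
  have htest : ∀ i n L s, t.num.toNat * 2 ^ (s * L) <
      t.den * lowMass (Accepts c D N i n L) (initSeg P s) L ↔
      (t : ℝ) < lowMass (Accepts c D N i n L) (initSeg P s) L / 2 ^ (s * L) := by
    intro i n L s
    rw [htd, div_lt_div_iff₀ hden (by positivity), mul_comm (lowMass _ _ _ : ℝ)]
    exact_mod_cast Iff.rfl
  have hsound : ∀ i n L s, t.num.toNat * 2 ^ (s * L) <
      t.den * lowMass (Accepts c D N i n L) (initSeg P s) L → i = q n := by
    intro i n L s hi
    rw [htest] at hi
    by_contra hne
    have hlt : (t : ℝ) < μ.real (E i n L) := hi.trans_le (lowMass_le hP _ _ _)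
    -- On `S` the code never outputs a wrong value, so wrong votes come only from `C \ S`, whose
    -- mass is too small to reach `t`.
    have hsub : S ∩ C ⊆ C \ E i n L := by
      rintro A ⟨hA, hAC⟩
      refine ⟨hAC, fun hAE => hne ?_⟩
      obtain ⟨-, j, -, hj⟩ := accepts_initSeg_iff.1 hAE
      exact (hA n i).2 ⟨j, Nat.Partrec.Code.evaln_sound hj⟩
    have hEC : E i n L ⊆ C := fun A hA => (accepts_initSeg_iff.1 hA).1.2
    have h1 : μ.real (S ∩ C) ≤ μ.real (C \ E i n L) := measureReal_mono hsub
    rw [measureReal_sdiff hEC (measurableSet_initSeg _ _)] at h1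
    linarith
  have hcomplete : ∀ n, ∃ L s, s.unpair.1 = L ∧ t.num.toNat * 2 ^ (s * L) <
      t.den * lowMass (Accepts c D N (q n) n L) (initSeg P s) L := by
    intro n
    have hmono : Monotone fun L => E (q n) n L := by
      intro L M hLM A hA
      obtain ⟨⟨h1, h2⟩, j, hj, h3⟩ := accepts_initSeg_iff.1 hA
      exact accepts_initSeg_iff.2 ⟨⟨h1.trans hLM, h2⟩, j, hj.trans_le hLM,
        Nat.Partrec.Code.evaln_mono hLM h3⟩
    -- `L` must reach the clopen level `N` and the step bound `k`, and exceed the use `j`.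
    have hsub : S ∩ C ⊆ ⋃ L, E (q n) n L := by
      rintro A ⟨hA, hAC⟩
      obtain ⟨j, hj⟩ := (hA n (q n)).1 rfl
      obtain ⟨k, hk⟩ := Nat.Partrec.Code.evaln_complete.1 hj
      refine Set.mem_iUnion.2 ⟨max (max N k) (j + 1), accepts_initSeg_iff.2 ⟨⟨?_, hAC⟩, j, ?_,
        Nat.Partrec.Code.evaln_mono ?_ hk⟩⟩ <;> omega
    have hlim : Tendsto (fun L => μ.real (E (q n) n L)) atTop (𝓝 (μ.real (⋃ L, E (q n) n L))) :=
      (ENNReal.tendsto_toReal (measure_ne_top _ _)).comp (tendsto_measure_iUnion_atTop hmono)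
    have hlt : (t : ℝ) < μ.real (⋃ L, E (q n) n L) := ht2.trans_le (measureReal_mono hsub)
    obtain ⟨L, hL⟩ := (hlim.eventually (lt_mem_nhds hlt)).exists
    obtain ⟨K, hK⟩ := eventually_atTop.1
      ((tendsto_lowMass hP (Accepts c D N (q n) n L) L).eventually (lt_mem_nhds hL))
    -- One number `s` carries both the string length `L` and the precision: it decodes to `L` and is
    -- at least `K`.
    exact ⟨L, Nat.pair L K, by simp, (htest _ _ _ _).2 (hK _ (Nat.right_le_pair _ _))⟩
  refine turingLE_of_search (primrec_vote c D N t.num.toNat t.den).to_comp ?_ ?_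
  · intro s n m hm
    simp only [vote, length_initSeg] at hm
    split_ifs at hm with h0 h1
    · cases hm; exact hsound _ _ _ _ h0
    · cases hm; exact hsound _ _ _ _ h1
  · intro n
    obtain ⟨_, s, rfl, hs⟩ := hcomplete n
    refine ⟨s, ?_⟩
    simp only [vote, length_initSeg]
    generalize q n = b at hs
    fin_cases b
    · rw [if_pos hs]; rfl
    -- Only the existence of an answer matters here; its correctness is `hsound`.
    · split_ifs with h0
      · rfl
      · rfl

/-- The cone above `q` is null unless `q` is computable from a binary expansion of `p`. -/
theorem turingLE_of_measure_cone_ne_zero {p : I} {P q : Cantor} (hP : IsBinaryExpansion P p)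
    (h : bernoulliProduct p (cone q) ≠ 0) : TuringLE q P := by
  have hsub : cone q ⊆ ⋃ c : Nat.Partrec.Code, {A | Computes c q A} := fun A hA =>
    Set.mem_iUnion.2 (exists_computes hA)
  have hne : bernoulliProduct p (⋃ c : Nat.Partrec.Code, {A | Computes c q A}) ≠ 0 :=
    fun h0 => h (measure_mono_null hsub h0)
  rw [Ne, measure_iUnion_null_iff, not_forall] at hne
  obtain ⟨c, hc⟩ := hne
  obtain ⟨N, T, hT⟩ := exists_clopen_density p hc
  exact turingLE_of_density hP hT

end BernoulliCone

theorem mainTheorem5 (p : unitInterval) (P : BernoulliCone.Cantor)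
    (hP : BernoulliCone.IsBinaryExpansion P (p : ℝ)) :
    (∀ q : BernoulliCone.Cantor, BernoulliCone.TuringLT P q →
      BernoulliCone.bernoulliProduct p (BernoulliCone.cone q) = 0) ∧
    (∀ q : BernoulliCone.Cantor,
      BernoulliCone.bernoulliProduct p (BernoulliCone.cone q) = 1 →
        BernoulliCone.TuringLE q P) := by
  refine ⟨fun q hq => ?_, fun q hq => ?_⟩
  · by_contra h
    exact hq.2 (BernoulliCone.turingLE_of_measure_cone_ne_zero hP h)
  · exact BernoulliCone.turingLE_of_measure_cone_ne_zero hP (by simp [hq])
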